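/- Let $k$ be a field. A $k$-variety is an irreducible and reduced scheme of finite type over $k$, and an algebraic group over $k$ is a group scheme of finite type over $k$. Let $X$ be a $k$-variety that is smooth over $k$, and let $A$ be an algebraic group that is proper over $k$. Then every rational map $\phi : X \dashrightarrow A$ over $k$ is a morphism: there is a unique morphism of $k$-schemes $f : X \to A$ whose class as a rational map is $\phi$. -/

import Mathlib

open CategoryTheory AlgebraicGeometry

universe u

/-- A variety over the field `k`: an irreducible and reduced scheme of finite type over `k`.
Neither separatedness nor geometric irreducibility is required. -/
class IsVarietyOver (k : Type u) [Field k] (X : Over (Spec (.of k))) : Prop where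
  irreducibleSpace : IrreducibleSpace X.left
  isReduced : IsReduced X.left
  locallyOfFiniteType : LocallyOfFiniteType X.hom
  quasiCompact : QuasiCompact X.hom

/-! ### Commutative algebra: associated primes of principal ideals in étale algebras over a UFD. -/

section

open IsLocalRing

/-! This is Weil's argument. By the valuative criterion, a rational map `f` to the proper group `A`
is defined at every point whose local ring is a valuation ring. On `X × X`, consider `(x, y) ↦ f(x)
f(y)⁻¹`. It equals `1` on the diagonal wherever `f` is defined, so near such points it lands in an
affine neighbourhood `V` of the identity. A map to an affine scheme extends across a closed set
whose ideal contains a regular sequence of length two, so the quotient extends to the local ring `R`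
of `X × X` at any diagonal point (`exists_extend_div`). Then `f(x) = (f(x) f(y)⁻¹) f(y)` with `y`
generic recovers `f` at `x` after a faithfully flat extension of the local ring of `x`, and
faithfully flat descent brings it down to `x` itself (`exists_extend_localRing`).

The regular sequence comes from an étale chart `Spec B` over affine space (`exists_regular_pair`).
The primes associated to a principal ideal of a local ring of `B` have valuation rings as local
rings, since `B` is flat and unramified over a polynomial ring, which is a UFD. Prime avoidance
gives a regular pair on the diagonal. The differences of coordinates form a regular sequence cutting
out the diagonal, so lifting the pair and permuting gives a regular pair in `R`. -/

/-- If a flat local extension of a UFD has its maximal ideal generated from below and of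
the form `(u : c)` with `c ∉ (u)`, then this maximal ideal is principal. -/
theorem isPrincipal_maximalIdeal_of_colon {P S : Type*} [CommRing P] [IsDomain P]
    [UniqueFactorizationMonoid P] [CommRing S] [IsLocalRing S] [IsDomain S] [Algebra P S]
    [Module.Flat P S]
    (hm : ((maximalIdeal S).comap (algebraMap P S)).map (algebraMap P S) = maximalIdeal S)
    {u c : S} (hu : u ≠ 0) (hc : ¬ u ∣ c) (h : ∀ y ∈ maximalIdeal S, u ∣ y * c) :
    (maximalIdeal S).IsPrincipal := by
  set p := (maximalIdeal S).comap (algebraMap P S) with hp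
  suffices p.IsPrincipal by
    obtain ⟨a, ha⟩ := this
    rw [← hm, ha]
    exact ⟨algebraMap P S a, by
      rw [Ideal.submodule_span_eq, Ideal.map_span, Set.image_singleton, Ideal.submodule_span_eq]⟩
  by_cases hp0 : p = ⊥
  · rw [hp0]; infer_instance
  obtain ⟨a, hap, ha⟩ := Ideal.IsPrime.exists_mem_prime_of_ne_bot (I := p) inferInstance hp0
  refine ⟨a, le_antisymm ?_ ((Ideal.span_singleton_le_iff_mem _).mpr hap)⟩
  -- If the prime `a` did not divide `b`, then `a, b` would be regular in `P`, hence in `S` by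
  -- flatness. From `a c = u d` and `b c = u e` follows `b d = a e`, so `a ∣ d` and then `u ∣ c`, a
  -- contradiction.
  intro b hb
  by_contra hab
  rw [Ideal.submodule_span_eq, Ideal.mem_span_singleton] at hab
  have hreg : RingTheory.Sequence.IsWeaklyRegular P [a, b] := by
    refine .cons ?_ (.cons ?_ (.nil _ _))
    · exact fun x y hxy ↦ mul_left_cancel₀ ha.ne_zero hxy
    · rw [isSMulRegular_quotient_iff_mem_of_smul_mem]
      intro x hx
      rw [Submodule.mem_smul_pointwise_iff_exists] at hx ⊢
      obtain ⟨y, -, hy⟩ := hx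
      obtain ⟨z, hz⟩ := (ha.dvd_or_dvd (Dvd.intro y hy)).resolve_left hab
      exact ⟨z, trivial, hz.symm⟩
  have := hreg.of_flat (S := S)
  simp only [List.map_cons, List.map_nil, RingTheory.Sequence.isWeaklyRegular_cons_iff] at this
  obtain ⟨h1, h2, -⟩ := this
  rw [isSMulRegular_quotient_iff_mem_of_smul_mem] at h2
  obtain ⟨d, hd⟩ := h _ hap
  obtain ⟨e, he⟩ := h _ hb
  set a' := algebraMap P S a
  set b' := algebraMap P S b
  have key : b' * d = a' * e := by
    apply mul_left_cancel₀ hu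
    linear_combination b' * (-hd) + a' * he
  have := h2 d ((Submodule.mem_smul_pointwise_iff_exists _ _ _).mpr ⟨e, trivial, key.symm⟩)
  obtain ⟨d', -, hd'⟩ := (Submodule.mem_smul_pointwise_iff_exists _ _ _).mp this
  rw [smul_eq_mul] at hd'
  refine hc ⟨d', h1 ?_⟩
  simp only [smul_eq_mul]
  linear_combination hd - u * hd'

/-- At an associated prime of a principal ideal, the local ring of an unramified flat
algebra over a UFD is a discrete valuation ring. -/
theorem valuationRing_localization_of_mem_associatedPrimes {P O : Type*} [CommRing P] [IsDomain P]
    [UniqueFactorizationMonoid P] [CommRing O] [IsDomain O] [IsNoetherianRing O] [Algebra P O]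
    [Module.Flat P O] [Algebra.FormallyUnramified P O] [Algebra.EssFiniteType P O]
    {u : O} (hu : u ≠ 0) (p : Ideal O) [p.IsPrime]
    (hp : p ∈ associatedPrimes O (O ⧸ Ideal.span {u})) :
    ValuationRing (Localization.AtPrime p) := by
  let S := Localization.AtPrime p
  let p₀ := p.under P
  have : Module.Flat P S := .trans P O S
  have : Algebra.FormallyUnramified O S := .of_isLocalization p.primeCompl
  have : Algebra.IsUnramifiedAt P p := Algebra.FormallyUnramified.comp P O S
  let := Localization.AtPrime.algebraOfLiesOver p₀ p
  have hm := ((Algebra.isUnramifiedAt_iff_map_eq P p₀ p).mp ‹_›).2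
  have hcomap : (maximalIdeal S).comap (algebraMap P S) = p₀ := by
    rw [IsScalarTower.algebraMap_eq P O S, ← Ideal.comap_comap]
    exact congr_arg (Ideal.comap (algebraMap P O)) (Localization.AtPrime.under_maximalIdeal (I := p))
  obtain ⟨-, c, hc⟩ := isAssociatedPrime_iff.mp hp
  obtain ⟨c, rfl⟩ := Ideal.Quotient.mk_surjective c
  have hpc (x : O) : x ∈ p ↔ u ∣ x * c := by
    rw [hc, Submodule.mem_colon_singleton, Submodule.mem_bot, ← Ideal.mem_span_singleton,
      ← Ideal.Quotient.eq_zero_iff_mem]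
    rfl
  have hprin : (maximalIdeal S).IsPrincipal := by
    refine isPrincipal_maximalIdeal_of_colon (P := P) (by rw [hcomap, hm])
      (u := algebraMap O S u) (c := algebraMap O S c) ?_ ?_ ?_
    · simpa using hu
    · rintro ⟨d, hd⟩
      obtain ⟨⟨d, s⟩, rfl⟩ := IsLocalization.mk'_surjective p.primeCompl d
      refine s.2 ((hpc _).mpr ⟨d, ?_⟩)
      apply IsLocalization.injective S p.primeCompl_le_nonZeroDivisors
      rw [map_mul, map_mul, hd, mul_left_comm, IsLocalization.mk'_spec']
    · intro y hy
      obtain ⟨⟨y, s⟩, rfl⟩ := IsLocalization.mk'_surjective p.primeCompl y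
      rw [IsLocalization.AtPrime.mk'_mem_maximal_iff S p] at hy
      obtain ⟨d, hd⟩ := (hpc _).mp hy
      refine ⟨IsLocalization.mk' S d s, ?_⟩
      rw [mul_comm, IsLocalization.mul_mk'_eq_mk'_of_mul, IsLocalization.mul_mk'_eq_mk'_of_mul,
        mul_comm c, hd]
  by_cases hf : IsField S
  · let := hf.toField
    infer_instance
  -- Entries 4 and 1 of the list: the maximal ideal is principal, and `S` is a valuation ring.
  · exact ((IsDiscreteValuationRing.TFAE S hf).out 4 1).mp hprin

/-- Prime avoidance: `J` lies in none of the finitely many primes associated to `O ⧸ (u)`, so some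
`v ∈ J` avoids them all and is regular modulo `u`. -/
theorem exists_mem_nonzero_of_not_le {O : Type*} [CommRing O] [IsDomain O] [IsNoetherianRing O]
    (hO : ∀ u : O, u ≠ 0 → ∀ p ∈ associatedPrimes O (O ⧸ Ideal.span {u}), ∀ _ : p.IsPrime,
      ValuationRing (Localization.AtPrime p)) (J : Ideal O)
    (hJ : ∀ (p : Ideal O) [p.IsPrime], ValuationRing (Localization.AtPrime p) → ¬ J ≤ p) :
    ∃ u ∈ J, u ≠ 0 ∧ ∃ v ∈ J, ∀ z, u ∣ v * z → u ∣ z := by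
  -- The local ring at the zero ideal is a field, so the hypothesis on `J` applies there too.
  have : J ≠ ⊥ := by
    rintro rfl
    refine hJ ⊥ ?_ le_rfl
    let := (IsField.toField <| (isField_iff_maximalIdeal_eq (R := Localization.AtPrime (⊥ : Ideal O))).mpr (by
      rw [← Localization.AtPrime.map_eq_maximalIdeal, Ideal.map_bot]))
    infer_instance
  obtain ⟨u, huJ, hu⟩ := Submodule.exists_mem_ne_zero_of_ne_bot this
  refine ⟨u, huJ, hu, ?_⟩
  have hfin := associatedPrimes.finite O (O ⧸ Ideal.span {u})
  -- The two `⊥` are the indices exempted from primality; every member is prime, so they are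
  -- placeholders.
  have := (Ideal.subset_union_prime_finite hfin (f := id) ⊥ ⊥ (I := J)
    (fun p hp _ _ ↦ hp.1)).not.mpr (by
      rintro ⟨p, hp, h⟩
      have := hp.1
      exact hJ p (hO u hu p hp hp.1) h)
  obtain ⟨v, hvJ, hv⟩ := Set.not_subset.mp this
  refine ⟨v, hvJ, fun z hz ↦ ?_⟩
  have := biUnion_associatedPrimes_eq_compl_regular O (O ⧸ Ideal.span {u})
  simp only [id_eq] at hv
  rw [this] at hv
  simp only [Set.mem_compl_iff, not_not, Set.mem_ofPred_eq] at hv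
  have := @hv (Ideal.Quotient.mk _ z) 0 (by
    simp only [smul_zero]
    rw [← Ideal.Quotient.mk_eq_mk, ← Submodule.Quotient.mk_smul, Ideal.Quotient.mk_eq_mk,
      Ideal.Quotient.eq_zero_iff_mem, Ideal.mem_span_singleton]
    exact hz)
  rwa [Ideal.Quotient.eq_zero_iff_mem, Ideal.mem_span_singleton] at this

end

/-! ### Regular sequences at the diagonal of `B ⊗ B`. -/

section

open IsLocalRing RingTheory.Sequence
open scoped TensorProduct

/-- Killing the earlier `X i - C (b i)` amounts to the substitution `e`. It fixes the next `X j - C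
(b j)`, a nonzero element of a domain. -/
theorem MvPolynomial.isWeaklyRegular_X_sub_C {B σ : Type*} [CommRing B] [IsDomain B] (b : σ → B)
    {l : List σ} (hl : l.Nodup) :
    IsWeaklyRegular (MvPolynomial σ B) (l.map fun i ↦ X i - C (b i)) := by
  classical
  rw [isWeaklyRegular_iff_Fin]
  intro i
  have hi : i.1 < l.length := by simpa using i.2
  simp only [Fin.getElem_fin, List.getElem_map]
  set l' := l.take i with hl'
  set j := l[i.1] with hj
  have hjl : j ∉ l' := by
    rw [hl', hj]
    intro h
    obtain ⟨a, ha, h⟩ := List.mem_take_iff_getElem.mp h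
    have := (List.Nodup.getElem_inj_iff hl).mp h
    lia
  set I := Ideal.ofList (l'.map fun i ↦ (X i - C (b i) : MvPolynomial σ B)) with hI
  let e : MvPolynomial σ B →ₐ[B] MvPolynomial σ B := aeval fun i ↦ if i ∈ l' then C (b i) else X i
  have he (p : MvPolynomial σ B) : p - e p ∈ I := by
    have : (Ideal.Quotient.mkₐ B I).comp e = Ideal.Quotient.mkₐ B I := by
      ext i
      by_cases h : i ∈ l'
      · simp only [AlgHom.comp_apply, e, aeval_X, h, if_true, Ideal.Quotient.mkₐ_eq_mk]
        refine (Ideal.Quotient.eq.mpr (Ideal.subset_span ?_)).symm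
        exact List.mem_map_of_mem (f := fun i ↦ (X i - C (b i) : MvPolynomial σ B)) h
      · simp [e, h]
    exact Ideal.Quotient.eq.mp congr($this p).symm
  have he0 : I ≤ RingHom.ker e := by
    rw [hI, Ideal.ofList, Ideal.span_le]
    intro x hx
    obtain ⟨i, hi, rfl⟩ := List.mem_map.mp hx
    simp [e, hi]
  have hIt : (I • ⊤ : Ideal (MvPolynomial σ B)) = I := by simp
  rw [← List.map_take, isSMulRegular_quotient_iff_mem_of_smul_mem, hIt]
  intro z hz
  have h1 : e ((X j - C (b j)) * z) = 0 := he0 hz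
  have h2 : e (X j - C (b j)) = X j - C (b j) := by simp [e, hjl]
  rw [map_mul, h2] at h1
  have h3 : (X j - C (b j) : MvPolynomial σ B) ≠ 0 := by
    intro h
    have := congr(MvPolynomial.coeff (Finsupp.single j 1) $h)
    simp [coeff_C, Finsupp.single_eq_zero, eq_comm (a := (0 : σ →₀ ℕ))] at this
  simpa [(mul_eq_zero.mp h1).resolve_left h3] using he z

section

variable {k B : Type u} [Field k] [CommRing B] [Algebra k B] {n : ℕ}
  [Algebra (MvPolynomial (Fin n) k) B] [IsScalarTower k (MvPolynomial (Fin n) k) B]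

variable (k B n) in
/-- The differences of the two pullbacks of the coordinates. -/
noncomputable def coordDiff (i : Fin n) : B ⊗[k] B :=
  1 ⊗ₜ algebraMap (MvPolynomial (Fin n) k) B (MvPolynomial.X i) -
    algebraMap (MvPolynomial (Fin n) k) B (MvPolynomial.X i) ⊗ₜ 1

/-- By base change `B ⊗ B` is flat over `B ⊗ k[X] = B[X]`, and the coordinate differences are the
images of the regular sequence `X i - b i`. -/
theorem isWeaklyRegular_coordDiff [IsDomain B] [Module.Flat (MvPolynomial (Fin n) k) B] :
    IsWeaklyRegular (B ⊗[k] B) (List.ofFn (coordDiff k B n)) := by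
  let P := MvPolynomial (Fin n) k
  let φ : B ⊗[k] P →ₐ[B] B ⊗[k] B :=
    Algebra.TensorProduct.lTensor B (IsScalarTower.toAlgHom k P B)
  have hφ : φ.Flat := by
    apply RingHom.Flat.lTensor
    change (algebraMap P B).Flat
    rwa [RingHom.flat_algebraMap_iff]
  let ψ : MvPolynomial (Fin n) B →ₐ[B] B ⊗[k] B :=
    φ.comp (MvPolynomial.algebraTensorAlgEquiv k B).symm.toAlgHom
  have hψ : ψ.toRingHom.Flat := by
    refine RingHom.Flat.comp (.of_bijective ?_) hφ
    exact (MvPolynomial.algebraTensorAlgEquiv (σ := Fin n) k B).symm.bijective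
  let := ψ.toRingHom.toAlgebra
  have : Module.Flat (MvPolynomial (Fin n) B) (B ⊗[k] B) := hψ
  have hl : List.ofFn (coordDiff k B n) = ((List.finRange n).map fun i ↦ MvPolynomial.X i -
      MvPolynomial.C (algebraMap P B (MvPolynomial.X i))).map
        (algebraMap (MvPolynomial (Fin n) B) (B ⊗[k] B)) := by
    rw [List.map_map, List.ofFn_eq_map]
    refine List.map_congr_left fun i _ ↦ ?_
    have hC (b : B) : (MvPolynomial.algebraTensorAlgEquiv (σ := Fin n) k B).symm
        (MvPolynomial.C b) = b ⊗ₜ 1 := (MvPolynomial.algebraTensorAlgEquiv k B).symm.commutes b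
    simp [RingHom.algebraMap_toAlgebra, ψ, φ, coordDiff, P, hC]
  rw [hl]
  exact (MvPolynomial.isWeaklyRegular_X_sub_C (fun i ↦ algebraMap P B (MvPolynomial.X i))
    (List.nodup_finRange n)).of_flat (S := B ⊗[k] B)

/-- Modulo the right-hand side, the two maps from `B` agree on the polynomial ring and differ by
elements of a square-zero ideal. Unramifiedness makes them equal, which puts every `1 ⊗ x - x ⊗ 1`
in the right-hand side. -/
theorem ker_lmul'_le [Algebra.FormallyUnramified (MvPolynomial (Fin n) k) B] :
    KaehlerDifferential.ideal k B ≤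
      Ideal.ofList (List.ofFn (coordDiff k B n)) ⊔ KaehlerDifferential.ideal k B ^ 2 := by
  let P := MvPolynomial (Fin n) k
  set I := KaehlerDifferential.ideal k B
  set I₀ := Ideal.ofList (List.ofFn (coordDiff k B n)) ⊔ I ^ 2
  let Q := (B ⊗[k] B) ⧸ I₀
  have h0 : Ideal.ofList (List.ofFn (coordDiff k B n)) ≤ I := by
    rw [Ideal.ofList, Ideal.span_le]
    intro x hx
    obtain ⟨i, rfl⟩ := (List.mem_ofFn' _ _).mp hx
    simp [I, KaehlerDifferential.ideal, coordDiff]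
  have hI₀ : I₀ ≤ I := sup_le h0 (Ideal.pow_le_self two_ne_zero)
  let f₁ : B →ₐ[k] Q := (Ideal.Quotient.mkₐ k I₀).comp Algebra.TensorProduct.includeLeft
  let f₂ : B →ₐ[k] Q := (Ideal.Quotient.mkₐ k I₀).comp Algebra.TensorProduct.includeRight
  have hf : f₁.comp (IsScalarTower.toAlgHom k P B) = f₂.comp (IsScalarTower.toAlgHom k P B) := by
    ext i
    refine (Ideal.Quotient.eq.mpr ?_).symm
    refine Ideal.mem_sup_left (Ideal.subset_span ?_)
    exact (List.mem_ofFn' _ _).mpr ⟨i, rfl⟩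
  let := (f₁.comp (IsScalarTower.toAlgHom k P B)).toRingHom.toAlgebra
  let g₁ : B →ₐ[P] Q := { f₁ with commutes' := fun r ↦ rfl }
  let g₂ : B →ₐ[P] Q := { f₂ with commutes' := fun r ↦ congr($hf r).symm }
  have hg : g₁ = g₂ := by
    refine Algebra.FormallyUnramified.ext (I := I.map (Ideal.Quotient.mk I₀)) ⟨2, ?_⟩ fun x ↦ ?_
    · rw [← Ideal.map_pow, Ideal.zero_eq_bot, Ideal.map_eq_bot_iff_le_ker, Ideal.mk_ker]
      exact le_sup_right
    · rw [Ideal.Quotient.eq]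
      change Ideal.Quotient.mk I₀ (x ⊗ₜ 1) - Ideal.Quotient.mk I₀ (1 ⊗ₜ x) ∈ _
      rw [← map_sub]
      apply Ideal.mem_map_of_mem
      simp [I, KaehlerDifferential.ideal]
  refine (KaehlerDifferential.span_range_eq_ideal k B).ge.trans ?_
  rw [Ideal.span_le]
  rintro _ ⟨x, rfl⟩
  exact Ideal.Quotient.eq.mp congr($hg x).symm

variable (q : Ideal B) [q.IsPrime]

variable (k) in
/-- The prime of `B ⊗ B` corresponding to the diagonal point over `q`. -/
noncomputable abbrev diagPrime : Ideal (B ⊗[k] B) :=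
  q.comap (Algebra.TensorProduct.lmul' k (S := B)).toRingHom

variable (k) in
/-- The restriction to the diagonal, on local rings. -/
noncomputable abbrev diagLocal :
    Localization.AtPrime (diagPrime k q) →+* Localization.AtPrime q :=
  Localization.localRingHom _ q (Algebra.TensorProduct.lmul' k (S := B)).toRingHom rfl

theorem diagLocal_surjective : Function.Surjective (diagLocal k q) := by
  apply RingHom.surjective_localRingHom_of_surjective
  exact fun b ↦ ⟨b ⊗ₜ 1, by simp⟩

/-- Nakayama's lemma turns the inclusion modulo the square, `ker_lmul'_le`, into an equality in the
local ring. -/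
theorem ker_diagLocal [IsNoetherianRing (B ⊗[k] B)]
    [Algebra.FormallyUnramified (MvPolynomial (Fin n) k) B] :
    RingHom.ker (diagLocal k q) = Ideal.ofList ((List.ofFn (coordDiff k B n)).map
      (algebraMap _ (Localization.AtPrime (diagPrime k q)))) := by
  let R := Localization.AtPrime (diagPrime k q)
  have hcomp (c : B ⊗[k] B) : diagLocal k q (algebraMap _ R c) =
      algebraMap B _ (Algebra.TensorProduct.lmul' k (S := B) c) :=
    Localization.localRingHom_to_map _ _ _ _ _
  rw [← Ideal.map_ofList]
  have hker : RingHom.ker (diagLocal k q) = (KaehlerDifferential.ideal k B).map (algebraMap _ R) := by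
    apply le_antisymm
    · intro z hz
      obtain ⟨⟨c, s⟩, rfl⟩ := IsLocalization.mk'_surjective (diagPrime k q).primeCompl z
      have h1 : diagLocal k q (algebraMap _ R c) = 0 := by
        rw [← IsLocalization.mk'_spec R c s, map_mul, hz, zero_mul]
      rw [hcomp, IsLocalization.map_eq_zero_iff q.primeCompl] at h1
      obtain ⟨r, hr⟩ := h1
      have h2 : r.1 ⊗ₜ 1 * c ∈ KaehlerDifferential.ideal k B := by
        rw [KaehlerDifferential.ideal, RingHom.mem_ker, map_mul]
        simpa using hr
      rw [IsLocalization.mk'_mem_map_algebraMap_iff (diagPrime k q).primeCompl]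
      exact ⟨_, by simpa [Ideal.primeCompl] using r.2, h2⟩
    · rw [Ideal.map_le_iff_le_comap]
      intro c hc
      rw [Ideal.mem_comap, RingHom.mem_ker, hcomp, hc, map_zero]
  rw [hker]
  apply le_antisymm
  · apply Submodule.le_of_le_smul_of_le_jacobson_bot (I := maximalIdeal R)
    · exact IsNoetherian.noetherian _
    · exact maximalIdeal_le_jacobson _
    · refine (Ideal.map_mono (ker_lmul'_le (n := n))).trans ?_
      rw [Ideal.map_sup, pow_two, Ideal.map_mul]
      refine sup_le_sup_left (Ideal.mul_mono_left ?_) _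
      rw [← hker]
      exact le_maximalIdeal (RingHom.ker_ne_top _)
  · apply Ideal.map_mono
    rw [Ideal.ofList, Ideal.span_le]
    intro x hx
    obtain ⟨i, rfl⟩ := (List.mem_ofFn' _ _).mp hx
    simp [KaehlerDifferential.ideal, coordDiff]

end

/-- On `B ⊗ B`, locally at a point of the diagonal, an ideal whose restriction to the diagonal
does not vanish at any point with a valuation ring as local ring contains a regular sequence of
length two. -/
theorem exists_regular_pair {k B : Type u} [Field k] [CommRing B] [IsDomain B] [Algebra k B] (n : ℕ)
    [Algebra (MvPolynomial (Fin n) k) B] [IsScalarTower k (MvPolynomial (Fin n) k) B]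
    [Algebra.Etale (MvPolynomial (Fin n) k) B] (q : Ideal B) [q.IsPrime]
    (J : Ideal (Localization.AtPrime (diagPrime k q)))
    (hJ : ∀ (p : Ideal (Localization.AtPrime q)) [p.IsPrime],
      ValuationRing (Localization.AtPrime p) → ¬ J ≤ p.comap (diagLocal k q)) :
    ∃ u ∈ J, ∃ v ∈ J, (∀ z, u * z = 0 → z = 0) ∧ ∀ z, u ∣ v * z → u ∣ z := by
  let P := MvPolynomial (Fin n) k
  let R := Localization.AtPrime (diagPrime k q)
  let O := Localization.AtPrime q
  -- Set apart because permuting a regular sequence below needs its members in the maximal ideal.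
  by_cases hJt : J = ⊤
  · exact ⟨1, hJt ▸ trivial, 1, hJt ▸ trivial, by simp, by simp⟩
  have : IsNoetherianRing B := Algebra.FiniteType.isNoetherianRing P B
  have : Algebra.FiniteType k B := .trans (S := P) inferInstance inferInstance
  have : Algebra.FiniteType k (B ⊗[k] B) := .trans (S := B) ‹_› inferInstance
  have : IsNoetherianRing (B ⊗[k] B) := Algebra.FiniteType.isNoetherianRing k _
  have : IsNoetherianRing R := IsLocalization.isNoetherianRing (diagPrime k q).primeCompl _ ‹_›
  have : Module.Flat P O := .trans P B O
  have : Algebra.FormallyUnramified B O := .of_isLocalization q.primeCompl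
  have : Algebra.FormallyUnramified P O := .comp P B O
  have : Algebra.EssFiniteType B O := .of_isLocalization _ q.primeCompl
  have : Algebra.EssFiniteType P O := .comp P B O
  have : IsNoetherianRing O := IsLocalization.isNoetherianRing q.primeCompl _ ‹_›
  obtain ⟨u', hu', hu0, v', hv', h⟩ := exists_mem_nonzero_of_not_le
    (fun u hu p hp _ ↦ valuationRing_localization_of_mem_associatedPrimes (P := P) hu p hp)
    (J.map (diagLocal k q)) fun p _ hp hle ↦ hJ p hp (Ideal.map_le_iff_le_comap.mp hle)
  have hs := diagLocal_surjective (k := k) q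
  obtain ⟨u, huJ, rfl⟩ := (Ideal.mem_map_iff_of_surjective _ hs).mp hu'
  obtain ⟨v, hvJ, rfl⟩ := (Ideal.mem_map_iff_of_surjective _ hs).mp hv'
  refine ⟨u, huJ, v, hvJ, ?_⟩
  set ts := (List.ofFn (coordDiff k B n)).map (algebraMap _ R)
  have hts : IsWeaklyRegular R ts := (isWeaklyRegular_coordDiff (k := k) (B := B) (n := n)).of_flat
  have hker : RingHom.ker (diagLocal k q) = Ideal.ofList ts := ker_diagLocal q
  have huv : IsWeaklyRegular R (ts ++ [u, v]) := by
    refine (isWeaklyRegular_append_iff _ _ _).mpr ⟨hts, ?_⟩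
    let := (diagLocal k q).toAlgebra
    let e : (R ⧸ (Ideal.ofList ts • ⊤ : Ideal R)) ≃ₗ[R] O :=
      (Submodule.quotEquivOfEq _ _ (by
        rw [smul_eq_mul, Ideal.mul_top, ← hker]; rfl)).trans
        ((Algebra.linearMap R O).quotKerEquivOfSurjective hs)
    rw [e.isWeaklyRegular_congr]
    refine .cons ?_ (.cons ?_ (.nil _ _))
    · exact fun x y hxy ↦ mul_left_cancel₀ hu0 hxy
    · rw [isSMulRegular_quotient_iff_mem_of_smul_mem]
      intro x hx
      rw [Submodule.mem_smul_pointwise_iff_exists] at hx ⊢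
      obtain ⟨y, -, hy⟩ := hx
      obtain ⟨z, hz⟩ := h x ⟨y, hy.symm⟩
      exact ⟨z, trivial, hz.symm⟩
  -- In a Noetherian local ring regularity survives permutation, so `u, v` can be moved to the
  -- front.
  have hperm : IsWeaklyRegular R ([u, v] ++ ts) := by
    refine IsLocalRing.isWeaklyRegular_of_perm_of_subset_maximalIdeal huv
      List.perm_append_comm fun r hr ↦ ?_
    rw [List.mem_append] at hr
    rcases hr with hr | hr
    · have : r ∈ RingHom.ker (diagLocal k q) := hker ▸ Ideal.subset_span hr
      exact le_maximalIdeal (RingHom.ker_ne_top _) this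
    · apply le_maximalIdeal hJt
      simp only [List.mem_cons, List.not_mem_nil, or_false] at hr
      rcases hr with rfl | rfl <;> assumption
  obtain ⟨h1, h2, -⟩ := by
    simpa only [List.cons_append, isWeaklyRegular_cons_iff] using hperm
  rw [isSMulRegular_quotient_iff_mem_of_smul_mem] at h2
  refine ⟨fun z hz ↦ h1 (by simpa using hz), fun z ⟨y, hy⟩ ↦ ?_⟩
  have := h2 z ((Submodule.mem_smul_pointwise_iff_exists _ _ _).mpr ⟨y, trivial, hy.symm⟩)
  obtain ⟨d, -, hd⟩ := (Submodule.mem_smul_pointwise_iff_exists _ _ _).mp this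
  exact ⟨d, hd.symm⟩

end

/-! ### A prime beside the diagonal, faithfully flat descent, and extension across codimension two.
-/

section

open IsLocalRing
open scoped TensorProduct

/-- For a domain `B` over a field, there is a point of `Spec (B ⊗ B)` specializing to the diagonal
point over `q`, lying over `q` on the left and over the generic point on the right. -/
theorem exists_prime_le_diagPrime (k : Type u) {B : Type u} [Field k] [CommRing B] [IsDomain B]
    [Algebra k B] (q : Ideal B) [q.IsPrime] :
    ∃ s : Ideal (B ⊗[k] B), s.IsPrime ∧ s ≤ diagPrime k q ∧
      (∀ b : B, b ⊗ₜ 1 ∈ s ↔ b ∈ q) ∧ ∀ b : B, 1 ⊗ₜ b ∈ s ↔ b = 0 := by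
  -- The left factor is reduced modulo `q` and the factors are swapped. In `B ⊗ (B ⧸ q)`, flat over
  -- `B`, the diagonal prime `ker μ` lies over `q`; going down to `⊥` makes the right coordinate
  -- generic.
  let ψ : B ⊗[k] B →ₐ[k] B ⊗[k] (B ⧸ q) :=
    (Algebra.TensorProduct.map (AlgHom.id k B) (Ideal.Quotient.mkₐ k q)).comp
      (Algebra.TensorProduct.comm k B B).toAlgHom
  let μ : B ⊗[k] (B ⧸ q) →ₐ[k] B ⧸ q :=
    Algebra.TensorProduct.lift (Ideal.Quotient.mkₐ k q) (AlgHom.id k _) fun _ _ ↦ .all _ _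
  have hμψ (c : B ⊗[k] B) : μ (ψ c) = Ideal.Quotient.mk q (Algebra.TensorProduct.lmul' k c) := by
    have : μ.comp ψ = (Ideal.Quotient.mkₐ k q).comp (Algebra.TensorProduct.lmul' k) := by
      ext <;> simp [μ, ψ]
    exact congr($this c)
  have hM : (RingHom.ker μ).IsPrime := RingHom.ker_isPrime _
  have hMq : (RingHom.ker μ).LiesOver q := by
    constructor
    ext b
    simp [Ideal.under, μ, Ideal.Quotient.eq_zero_iff_mem]
  have : Module.Flat B (B ⊗[k] (B ⧸ q)) := Module.Flat.baseChange k B (B ⧸ q)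
  have : Algebra.HasGoingDown B (B ⊗[k] (B ⧸ q)) := Algebra.HasGoingDown.of_flat
  obtain ⟨s, hs, hsp, hso⟩ := Ideal.exists_ideal_le_liesOver_of_le
    (p := (⊥ : Ideal B)) (q := q) (RingHom.ker μ) bot_le
  refine ⟨s.comap ψ, inferInstance, fun c hc ↦ ?_, fun b ↦ ⟨fun hb ↦ ?_, fun hb ↦ ?_⟩, fun b ↦ ?_⟩
  · have := hs hc
    rw [RingHom.mem_ker, hμψ, Ideal.Quotient.eq_zero_iff_mem] at this
    exact this
  · have := hs hb
    rw [RingHom.mem_ker, hμψ, Ideal.Quotient.eq_zero_iff_mem] at this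
    simpa using this
  · have : ψ (b ⊗ₜ 1) = 0 := by
      simp [ψ, Ideal.Quotient.eq_zero_iff_mem.mpr hb]
    rw [Ideal.mem_comap, this]
    exact zero_mem _
  · have h2 : b ∈ s.under B ↔ b = 0 := by rw [← hso.over]; rfl
    rw [← h2, Ideal.mem_comap]
    simp [ψ, Ideal.under]

theorem RingHom.exists_comp_eq_of_injective {D R T : Type*} [CommRing D] [CommRing R] [CommRing T]
    {f : R →+* T} (hf : Function.Injective f) (g : D →+* T) (h : ∀ d, ∃ r, f r = g d) :
    ∃ γ : D →+* R, f.comp γ = g := by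
  choose γ hγ using h
  refine ⟨⟨⟨⟨γ, ?_⟩, ?_⟩, ?_, ?_⟩, RingHom.ext hγ⟩
  all_goals intros; apply hf; simp [hγ]

/-- A homomorphism to the fraction field of a domain `O` which becomes integral over a faithfully
flat extension of `O` takes values in `O`. -/
theorem exists_comp_eq_of_faithfullyFlat {O S K L D : Type*} [CommRing O] [IsDomain O] [Field K]
    [Algebra O K] [IsFractionRing O K] [CommRing S] [Algebra O S] [Module.FaithfullyFlat O S]
    [CommRing L] [CommRing D] {i : S →+* L} (hi : Function.Injective i) {j : K →+* L}
    (hij : j.comp (algebraMap O K) = i.comp (algebraMap O S)) {α : D →+* S} {β : D →+* K}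
    (h : i.comp α = j.comp β) : ∃ γ : D →+* O, (algebraMap O K).comp γ = β := by
  refine RingHom.exists_comp_eq_of_injective (IsFractionRing.injective O K) β fun d ↦ ?_
  obtain ⟨⟨b, a⟩, hab⟩ := IsLocalization.mk'_surjective (nonZeroDivisors O) (β d)
  have hS : algebraMap O S b = algebraMap O S a * α d := by
    apply hi
    have h1 : algebraMap O K b = algebraMap O K a * β d := by
      rw [← hab, IsLocalization.mk'_spec']
    have h2 := congr(j $h1)
    rw [map_mul] at h2 ⊢
    have e1 (x) : j (algebraMap O K x) = i (algebraMap O S x) := congr($hij x)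
    have e2 : i (α d) = j (β d) := congr($h d)
    rw [← e1, ← e1, h2, e2]
  -- Faithful flatness gives `aS ∩ O = aO`, so the fraction `b / a` already lies in `O`.
  have hb : b ∈ Ideal.span {(a : O)} := by
    rw [← Ideal.comap_map_eq_self_of_faithfullyFlat (B := S) (Ideal.span {(a : O)}),
      Ideal.mem_comap, Ideal.map_span, Set.image_singleton, Ideal.mem_span_singleton]
    exact ⟨_, hS⟩
  obtain ⟨c, rfl⟩ := Ideal.mem_span_singleton.mp hb
  refine ⟨c, ?_⟩
  rw [← hab, IsLocalization.eq_mk'_iff_mul_eq, ← map_mul, mul_comm]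

/-- Write `x = a / uⁿ` and `y = b / vᵐ`. After cancelling powers of `u`, equality over `D(uv)` says
that `uⁿ` divides `a` times a power of `v`. As `v` is regular modulo `u`, it is regular modulo `uⁿ`,
so `uⁿ ∣ a`. -/
theorem exists_algebraMap_eq_of_regular_pair {R Ru Rv Ruv : Type*} [CommRing R] {u v : R}
    (hu : ∀ z, u * z = 0 → z = 0) (huv : ∀ z, u ∣ v * z → u ∣ z) [CommRing Ru] [Algebra R Ru]
    [IsLocalization.Away u Ru] [CommRing Rv] [Algebra R Rv] [IsLocalization.Away v Rv]
    [CommRing Ruv] [Algebra R Ruv] [IsLocalization.Away (u * v) Ruv] (f : Ru →ₐ[R] Ruv)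
    (g : Rv →ₐ[R] Ruv) (x : Ru) (y : Rv) (hxy : f x = g y) : ∃ r, algebraMap R Ru r = x := by
  obtain ⟨n, a, ha⟩ := IsLocalization.Away.surj u x
  obtain ⟨m, b, hb⟩ := IsLocalization.Away.surj v y
  have h1 := congr(f $ha)
  have h2 := congr(g $hb)
  simp only [map_mul, AlgHom.commutes, ← map_pow] at h1 h2
  have h3 : algebraMap R Ruv (a * v ^ m) = algebraMap R Ruv (b * u ^ n) := by
    rw [map_mul, map_mul, ← h1, ← h2, hxy]; ring
  obtain ⟨⟨_, N, rfl⟩, hN⟩ := (IsLocalization.eq_iff_exists (Submonoid.powers (u * v)) _).mp h3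
  simp only [mul_pow] at hN
  have hu' (l : ℕ) : ∀ z, u ^ l * z = 0 → z = 0 := by
    induction l with
    | zero => simp
    | succ l ih => exact fun z hz ↦ hu z (ih _ (by rw [← hz]; ring))
  have hv' (l : ℕ) : ∀ z, u ∣ v ^ l * z → u ∣ z := by
    induction l with
    | zero => simp
    | succ l ih => exact fun z hz ↦ huv z (ih _ (by rwa [← mul_assoc, ← pow_succ]))
  have huv' (l l' : ℕ) : ∀ z, u ^ l ∣ v ^ l' * z → u ^ l ∣ z := by
    induction l with
    | zero => simp
    | succ l ih =>
      intro z hz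
      obtain ⟨w, rfl⟩ := hv' l' z ((dvd_pow_self u l.succ_ne_zero).trans hz)
      obtain ⟨t, ht⟩ := hz
      have : u * (v ^ l' * w - u ^ l * t) = 0 := by linear_combination ht
      have := ih w ⟨t, sub_eq_zero.mp (hu _ this)⟩
      rw [pow_succ']
      exact mul_dvd_mul_left u this
  have h4 : u ^ N * (v ^ (N + m) * a - u ^ n * (v ^ N * b)) = 0 := by
    linear_combination hN
  obtain ⟨r, rfl⟩ := huv' n (N + m) a ⟨_, sub_eq_zero.mp (hu' N _ h4)⟩
  refine ⟨r, ?_⟩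
  have hunit : IsUnit (algebraMap R Ru u ^ n) := (IsLocalization.Away.algebraMap_isUnit u).pow n
  apply hunit.mul_left_cancel
  rw [mul_comm _ x, ha, map_mul, map_pow]

/-- A morphism to an affine scheme defined on an open subset of `Spec R` containing `D(u)` and
`D(v)` for a regular sequence `u, v` extends to `Spec R`. -/
theorem exists_extend_of_regular_pair {R D : Type u} [CommRing R] [CommRing D] {u v : R}
    (hu : ∀ z, u * z = 0 → z = 0) (huv : ∀ z, u ∣ v * z → u ∣ z) (W : (Spec (.of R)).Opens)
    (huW : PrimeSpectrum.basicOpen u ≤ W) (hvW : PrimeSpectrum.basicOpen v ≤ W)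
    (g : W.toScheme ⟶ Spec (.of D)) :
    ∃ Ψ : Spec (.of R) ⟶ Spec (.of D), ∀ {L : Type u} [CommRing L] (τ : R →+* L)
      (_ : IsUnit (τ u)) (t : Spec (.of L) ⟶ W) (_ : t ≫ W.ι = Spec.map (CommRingCat.ofHom τ)),
      t ≫ g = Spec.map (CommRingCat.ofHom τ) ≫ Ψ := by
  let Ru := Localization.Away u
  let Rv := Localization.Away v
  let Ruv := Localization.Away (u * v)
  have hlift (w : R) (hw : PrimeSpectrum.basicOpen w ≤ W) :
      ∃ t : Spec (.of (Localization.Away w)) ⟶ W,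
        t ≫ W.ι = Spec.map (CommRingCat.ofHom (algebraMap R _)) := by
    refine ⟨IsOpenImmersion.lift W.ι (Spec.map (CommRingCat.ofHom (algebraMap R _))) ?_,
      IsOpenImmersion.lift_fac _ _ _⟩
    rw [Scheme.Opens.range_ι]
    refine subset_trans ?_ hw
    exact (PrimeSpectrum.localization_away_comap_range (Localization.Away w) w).le
  obtain ⟨tu, htu⟩ := hlift u huW
  obtain ⟨tv, htv⟩ := hlift v hvW
  let f : Ru →ₐ[R] Ruv := IsLocalization.liftAlgHom (M := .powers u) (f := Algebra.ofId R Ruv) (by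
    rintro ⟨_, n, rfl⟩
    rw [map_pow, Algebra.ofId_apply]
    exact (isUnit_of_mul_isUnit_left (y := algebraMap R Ruv v) (by
      rw [← map_mul]; exact IsLocalization.Away.algebraMap_isUnit (u * v))).pow n)
  let f' : Rv →ₐ[R] Ruv := IsLocalization.liftAlgHom (M := .powers v) (f := Algebra.ofId R Ruv) (by
    rintro ⟨_, n, rfl⟩
    rw [map_pow, Algebra.ofId_apply]
    exact (isUnit_of_mul_isUnit_right (x := algebraMap R Ruv u) (by
      rw [← map_mul]; exact IsLocalization.Away.algebraMap_isUnit (u * v))).pow n)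
  let su := Spec.preimage (tu ≫ g)
  let sv := Spec.preimage (tv ≫ g)
  have hsuv : su ≫ CommRingCat.ofHom f.toRingHom = sv ≫ CommRingCat.ofHom f'.toRingHom := by
    apply Spec.map_injective
    rw [Spec.map_comp, Spec.map_comp, Spec.map_preimage, Spec.map_preimage, ← Category.assoc,
      ← Category.assoc]
    congr 1
    rw [← cancel_mono W.ι, Category.assoc, Category.assoc, htu, htv, ← Spec.map_comp,
      ← Spec.map_comp, ← CommRingCat.ofHom_comp, ← CommRingCat.ofHom_comp]
    congr 2
    exact f.comp_algebraMap.trans f'.comp_algebraMap.symm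
  have hinj : Function.Injective (algebraMap R Ru) := by
    refine IsLocalization.injective (M := .powers u) _ (Submonoid.powers_le.mpr ?_)
    rw [mem_nonZeroDivisors_iff]
    exact ⟨hu, fun z hz ↦ hu z (by rwa [mul_comm])⟩
  obtain ⟨γ, hγ⟩ := RingHom.exists_comp_eq_of_injective hinj su.hom fun d ↦
    exists_algebraMap_eq_of_regular_pair hu huv f f' _ (sv.hom d) congr($hsuv d)
  refine ⟨Spec.map (CommRingCat.ofHom γ), fun {L} _ τ hτ t ht ↦ ?_⟩
  let τ' : Ru →+* L := IsLocalization.Away.lift u hτ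
  have hτ' : τ'.comp (algebraMap R Ru) = τ := IsLocalization.Away.lift_comp u hτ
  have h1 : t = Spec.map (CommRingCat.ofHom τ') ≫ tu := by
    rw [← cancel_mono W.ι, ht, Category.assoc, htu, ← Spec.map_comp, ← CommRingCat.ofHom_comp, hτ']
  rw [h1, Category.assoc, ← Spec.map_preimage (tu ≫ g), ← Spec.map_comp, ← Spec.map_comp]
  congr 1
  ext d
  have := congr(τ' ($hγ d))
  simp only [RingHom.comp_apply] at this
  simp [← hτ', this, su]

end

/-! ### The map `(x, y) ↦ f(x) f(y)⁻¹` near the diagonal. -/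

section

open IsLocalRing
open scoped TensorProduct MonObj
open MonoidalCategory CartesianMonoidalCategory

/-- An open subscheme of a scheme over `S`, as a scheme over `S`. -/
noncomputable abbrev overOpens {S : Scheme.{u}} (Y : Over S) (W : Y.left.Opens) : Over S :=
  Over.mk (W.ι ≫ Y.hom)

/-- The inclusion of an open subscheme over `S`. -/
noncomputable abbrev overOpensι {S : Scheme.{u}} (Y : Over S) (W : Y.left.Opens) :
    overOpens Y W ⟶ Y :=
  Over.homMk W.ι

instance {S : Scheme.{u}} (Y : Over S) (W : Y.left.Opens) : Mono (overOpensι Y W) :=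
  have : Mono (overOpensι Y W).left := inferInstanceAs (Mono W.ι)
  Over.mono_of_mono_left _

theorem exists_lift_overOpens {S : Scheme.{u}} {T Y : Over S} (W : Y.left.Opens) (t : T ⟶ Y)
    (h : ∀ x, t.left x ∈ W) : ∃ a : T ⟶ overOpens Y W, a ≫ overOpensι Y W = t := by
  have hr : Set.range t.left ⊆ Set.range W.ι := by
    rw [Scheme.Opens.range_ι]
    rintro _ ⟨x, rfl⟩
    exact h x
  refine ⟨Over.homMk (IsOpenImmersion.lift W.ι t.left hr) ?_, ?_⟩
  · change _ ≫ W.ι ≫ Y.hom = _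
    rw [IsOpenImmersion.lift_fac_assoc, Over.w]
  · ext1
    exact IsOpenImmersion.lift_fac _ _ _

section

variable (k : Type u) [Field k]

/-- The spectrum of a `k`-algebra, as a scheme over `k`. -/
noncomputable abbrev specOver (R : Type u) [CommRing R] [Algebra k R] : Over (Spec (.of k)) :=
  Over.mk (Spec.map (CommRingCat.ofHom (algebraMap k R)))

variable {k}

/-- The morphism of `k`-schemes given by a homomorphism of `k`-algebras. -/
noncomputable abbrev specOverMap {R L : Type u} [CommRing R] [Algebra k R] [CommRing L]
    [Algebra k L] (f : R →ₐ[k] L) : specOver k L ⟶ specOver k R :=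
  Over.homMk (Spec.map (CommRingCat.ofHom f.toRingHom)) (by
    change Spec.map _ ≫ Spec.map _ = Spec.map _
    rw [← Spec.map_comp, ← CommRingCat.ofHom_comp]
    congr 2
    exact f.comp_algebraMap)

theorem specOverMap_comp {R L M : Type u} [CommRing R] [Algebra k R] [CommRing L]
    [Algebra k L] [CommRing M] [Algebra k M] (f : R →ₐ[k] L) (g : L →ₐ[k] M) :
    specOverMap g ≫ specOverMap f = specOverMap (g.comp f) := by
  ext1
  change Spec.map _ ≫ Spec.map _ = Spec.map _
  rw [← Spec.map_comp, ← CommRingCat.ofHom_comp]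
  rfl

variable {B : Type u} [CommRing B] [Algebra k B] (q : Ideal B) [q.IsPrime]

variable (k) in
/-- The first projection, on the local ring of a diagonal point. -/
noncomputable abbrev diagLeft : B →ₐ[k] Localization.AtPrime (diagPrime k q) :=
  (IsScalarTower.toAlgHom k (B ⊗[k] B) _).comp Algebra.TensorProduct.includeLeft

variable (k) in
/-- The second projection, on the local ring of a diagonal point. -/
noncomputable abbrev diagRight : B →ₐ[k] Localization.AtPrime (diagPrime k q) :=
  (IsScalarTower.toAlgHom k (B ⊗[k] B) _).comp Algebra.TensorProduct.includeRight

theorem diagLocal_diagLeft (b : B) : diagLocal k q (diagLeft k q b) = algebraMap B _ b := by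
  refine (Localization.localRingHom_to_map _ _ _ _ _).trans ?_
  simp

theorem diagLocal_diagRight (b : B) : diagLocal k q (diagRight k q b) = algebraMap B _ b := by
  refine (Localization.localRingHom_to_map _ _ _ _ _).trans ?_
  simp

variable (k) in
/-- The restriction to the diagonal, as a homomorphism of `k`-algebras. -/
noncomputable abbrev diagLocalAlgHom :
    Localization.AtPrime (diagPrime k q) →ₐ[k] Localization.AtPrime q :=
  { diagLocal k q with
    commutes' := fun r ↦ by
      have := diagLocal_diagLeft (k := k) q (algebraMap k B r)
      rw [AlgHom.commutes, ← IsScalarTower.algebraMap_apply] at this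
      exact this }

/-- Used at points of the diagonal, where the two projections agree. -/
theorem div_comp_eq_one {C : Type*} [Category* C] [CartesianMonoidalCategory C]
    {T W Y U A : C} [GrpObj A]
    {i : W ⟶ T} {j : U ⟶ Y} [Mono j] {p₁ p₂ : T ⟶ Y} {b₁ b₂ : W ⟶ U} (h₁ : b₁ ≫ j = i ≫ p₁)
    (h₂ : b₂ ≫ j = i ≫ p₂) (F : U ⟶ A) {Z : C} (c : Z ⟶ W) (hc : c ≫ i ≫ p₁ = c ≫ i ≫ p₂) :
    c ≫ ((b₁ ≫ F) / (b₂ ≫ F)) = 1 := by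
  have : c ≫ b₁ = c ≫ b₂ := by
    rw [← cancel_mono j, Category.assoc, Category.assoc, h₁, h₂, hc]
  rw [GrpObj.comp_div, reassoc_of% this, div_self']

theorem valuationRing_comap_algebraMap {B : Type*} [CommRing B] [IsDomain B] (q : Ideal B)
    [q.IsPrime] (p : Ideal (Localization.AtPrime q)) [p.IsPrime]
    [ValuationRing (Localization.AtPrime p)] :
    ValuationRing (Localization.AtPrime (p.comap (algebraMap B (Localization.AtPrime q)))) :=
  let e := IsLocalization.localizationLocalizationAtPrimeIsoLocalization q.primeCompl p
  Function.Surjective.valuationRing e.symm.toAlgHom.toRingHom e.symm.surjective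

/-- Allows an identity over `Spec R` to be checked on `D(u)` alone, with `L = R_u`. -/
theorem exists_injective_isUnit {R : Type u} [CommRing R] {u : R} (hu : ∀ z, u * z = 0 → z = 0) :
    ∃ (L : Type u) (_ : CommRing L) (τ : R →+* L), Function.Injective τ ∧ IsUnit (τ u) := by
  refine ⟨Localization.Away u, inferInstance, algebraMap R _, ?_,
    IsLocalization.Away.algebraMap_isUnit u⟩
  refine IsLocalization.injective (M := .powers u) _ (Submonoid.powers_le.mpr ?_)
  rw [mem_nonZeroDivisors_iff]
  exact ⟨hu, fun z hz ↦ hu z (by rwa [mul_comm])⟩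

theorem Spec_hom_ext_of_injective {R L D : Type u} [CommRing R] [CommRing L] [CommRing D]
    {τ : R →+* L} (hτ : Function.Injective τ) {a b : Spec (.of R) ⟶ Spec (.of D)}
    (h : Spec.map (CommRingCat.ofHom τ) ≫ a = Spec.map (CommRingCat.ofHom τ) ≫ b) : a = b := by
  obtain ⟨a, rfl⟩ := Spec.map_surjective a
  obtain ⟨b, rfl⟩ := Spec.map_surjective b
  rw [← Spec.map_comp, ← Spec.map_comp] at h
  congr 1
  ext x
  exact hτ congr($(Spec.map_injective h) x)

/-- The map `(x, y) ↦ f(x) f(y)⁻¹` to a group scheme extends to the local ring at a point of the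
diagonal if `f` is defined at all points whose local ring is a valuation ring. -/
theorem exists_extend_div [IsDomain B] (n : ℕ) [Algebra (MvPolynomial (Fin n) k) B]
    [IsScalarTower k (MvPolynomial (Fin n) k) B] [Algebra.Etale (MvPolynomial (Fin n) k) B]
    (A : Over (Spec (.of k))) [GrpObj A] (U : (specOver k B).left.Opens)
    (F : overOpens (specOver k B) U ⟶ A)
    (hU : ∀ (p : Ideal B) [hp : p.IsPrime], ValuationRing (Localization.AtPrime p) →
      (⟨p, hp⟩ : PrimeSpectrum B) ∈ U) :
    ∃ (Ψ : specOver k (Localization.AtPrime (diagPrime k q)) ⟶ A)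
      (u : Localization.AtPrime (diagPrime k q)), (∀ z, u * z = 0 → z = 0) ∧
      ∀ (L : Type u) [CommRing L] [Algebra k L]
        (τ : Localization.AtPrime (diagPrime k q) →ₐ[k] L), IsUnit (τ u) →
        ∀ a₁ a₂ : specOver k L ⟶ overOpens (specOver k B) U,
          a₁ ≫ overOpensι _ U = specOverMap (τ.comp (diagLeft k q)) →
          a₂ ≫ overOpensι _ U = specOverMap (τ.comp (diagRight k q)) →
          specOverMap τ ≫ Ψ = (a₁ ≫ F) / (a₂ ≫ F) := by
  let R := Localization.AtPrime (diagPrime k q)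
  let Y := specOver k B
  let T := specOver k R
  let p₁ : T ⟶ Y := specOverMap (diagLeft k q)
  let p₂ : T ⟶ Y := specOverMap (diagRight k q)
  let W₀ : T.left.Opens := p₁.left ⁻¹ᵁ U ⊓ p₂.left ⁻¹ᵁ U
  obtain ⟨b₁, hb₁⟩ := exists_lift_overOpens U (overOpensι T W₀ ≫ p₁) fun x ↦ x.2.1
  obtain ⟨b₂, hb₂⟩ := exists_lift_overOpens U (overOpensι T W₀ ≫ p₂) fun x ↦ x.2.2
  let G : overOpens T W₀ ⟶ A := (b₁ ≫ F) / (b₂ ≫ F)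
  have : Nonempty (𝟙_ (Over (Spec (.of k)))).left := inferInstanceAs (Nonempty (Spec (.of k)))
  have hsub : Subsingleton (𝟙_ (Over (Spec (.of k)))).left :=
    inferInstanceAs (Subsingleton (Spec (.of k)))
  obtain ⟨o⟩ := this
  obtain ⟨V, hV, heV, -⟩ :=
    exists_isAffineOpen_mem_and_subset (U := ⊤) (x := η[A].left o) trivial
  -- The locus where the quotient is defined and lands in the affine neighbourhood `V` of the
  -- identity.
  let W : T.left.Opens := W₀.ι ''ᵁ (G.left ⁻¹ᵁ V)
  have hWW₀ : W ≤ W₀ := by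
    rintro _ ⟨x, -, rfl⟩
    exact x.2
  let h : W.toScheme ⟶ W₀.toScheme := T.left.homOfLE hWW₀
  have hh : h ≫ W₀.ι = W.ι := T.left.homOfLE_ι hWW₀
  have hhV : Set.range (h ≫ G.left) ⊆ Set.range V.ι := by
    rw [Scheme.Opens.range_ι]
    rintro _ ⟨x, rfl⟩
    obtain ⟨y, hy, hyx⟩ := x.2
    have : h x = y := Subtype.ext ((congr($hh x) : (h x).1 = x.1).trans hyx.symm)
    rw [Scheme.Hom.comp_apply, this]
    exact hy
  let g₀ := IsOpenImmersion.lift V.ι (h ≫ G.left) hhV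
  let J : Ideal R := PrimeSpectrum.vanishingIdeal {x : PrimeSpectrum R | x ∉ W}
  have hJW {w : R} (hw : w ∈ J) : PrimeSpectrum.basicOpen w ≤ W := by
    intro x hx
    by_contra hxW
    exact hx ((PrimeSpectrum.mem_vanishingIdeal _ _).mp hw x hxW)
  -- At a diagonal point with valuation local ring, both projections land in `U` and agree on the
  -- residue field. The quotient is `1` there, so the point is in `W` and `J` does not vanish at it.
  obtain ⟨u, huJ, v, hvJ, hu, huv⟩ := exists_regular_pair n q J (fun p hp hval hle ↦ by
    let κ := p.ResidueField
    let ρ : R →ₐ[k] κ := (IsScalarTower.toAlgHom k (Localization.AtPrime q) κ).comp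
      (diagLocalAlgHom k q)
    have hρ : ρ.comp (diagLeft k q) = ρ.comp (diagRight k q) := by
      ext b
      change algebraMap _ κ (diagLocal k q (diagLeft k q b)) =
        algebraMap _ κ (diagLocal k q (diagRight k q b))
      rw [diagLocal_diagLeft, diagLocal_diagRight]
    let t : specOver k κ ⟶ T := specOverMap ρ
    have ht : t ≫ p₁ = t ≫ p₂ := by
      rw [specOverMap_comp, specOverMap_comp, hρ]
    let x : PrimeSpectrum κ := ⊥
    let p' : PrimeSpectrum R := ⟨p.comap (diagLocal k q), inferInstance⟩
    have htx (x : PrimeSpectrum κ) : t.left x = p' := by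
      obtain rfl : x = ⊥ := Subsingleton.elim _ _
      refine PrimeSpectrum.ext (Ideal.ext fun r ↦ ?_)
      exact Ideal.algebraMap_residueField_eq_zero (I := p) (x := diagLocal k q r)
    have hpU : (⟨p.comap (algebraMap B _), inferInstance⟩ : PrimeSpectrum B) ∈ U :=
      hU _ (valuationRing_comap_algebraMap q p)
    have hp₁ : p₁.left p' = (⟨p.comap (algebraMap B _), inferInstance⟩ : PrimeSpectrum B) := by
      refine PrimeSpectrum.ext (Ideal.ext fun b ↦ ?_)
      exact iff_of_eq (congr_arg (· ∈ p) (diagLocal_diagLeft (k := k) q b))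
    have hp₂ : p₂.left p' = (⟨p.comap (algebraMap B _), inferInstance⟩ : PrimeSpectrum B) := by
      refine PrimeSpectrum.ext (Ideal.ext fun b ↦ ?_)
      exact iff_of_eq (congr_arg (· ∈ p) (diagLocal_diagRight (k := k) q b))
    have hW₀ (x) : t.left x ∈ W₀ := by
      rw [htx x]
      have h₁ : p₁.left p' ∈ U := by rw [hp₁]; exact hpU
      have h₂ : p₂.left p' ∈ U := by rw [hp₂]; exact hpU
      exact ⟨h₁, h₂⟩
    obtain ⟨c, hc⟩ := exists_lift_overOpens W₀ t hW₀
    have hcG : c ≫ G = 1 := div_comp_eq_one hb₁ hb₂ F c (by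
      rw [reassoc_of% hc, reassoc_of% hc, ht])
    have hcV : c.left x ∈ G.left ⁻¹ᵁ V := by
      change (c ≫ G).left x ∈ V
      rw [hcG, Hom.one_def]
      change η[A].left _ ∈ V
      convert heV
    have hmem : p' ∈ W := by
      rw [← htx x]
      exact ⟨c.left x, hcV, congr(Over.Hom.left $hc x)⟩
    have hcl : p' ∈ PrimeSpectrum.zeroLocus (J : Set R) := hle
    have hclosed : IsClosed {x : PrimeSpectrum R | x ∉ W} := isClosed_compl_iff.mpr W.isOpen
    rw [PrimeSpectrum.zeroLocus_vanishingIdeal_eq_closure, hclosed.closure_eq] at hcl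
    exact hcl hmem)
  obtain ⟨Ψ₀, hΨ₀⟩ := exists_extend_of_regular_pair (D := Γ(A.left, V)) hu huv W (hJW huJ)
    (hJW hvJ) (g₀ ≫ hV.isoSpec.hom)
  let Ψ₁ : T.left ⟶ A.left := Ψ₀ ≫ hV.isoSpec.inv ≫ V.ι
  have hΨ₁ {L : Type u} [CommRing L] (τ : R →+* L) (hτ : IsUnit (τ u)) : 
      ∃ t : Spec (.of L) ⟶ W, t ≫ W.ι = Spec.map (CommRingCat.ofHom τ) ∧
        t ≫ h ≫ G.left = Spec.map (CommRingCat.ofHom τ) ≫ Ψ₁ := by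
    have hr : Set.range (Spec.map (CommRingCat.ofHom τ)) ⊆ Set.range W.ι := by
      rw [Scheme.Opens.range_ι]
      rintro _ ⟨x, rfl⟩
      refine hJW huJ ?_
      change τ u ∉ x.asIdeal
      exact fun hx ↦ x.2.ne_top (Ideal.eq_top_of_isUnit_mem _ hx hτ)
    refine ⟨IsOpenImmersion.lift W.ι _ hr, IsOpenImmersion.lift_fac _ _ _, ?_⟩
    have := hΨ₀ τ hτ _ (IsOpenImmersion.lift_fac W.ι _ hr)
    simp only [Ψ₁]
    rw [← reassoc_of% this, Iso.hom_inv_id_assoc, IsOpenImmersion.lift_fac]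
  have hΨk : Ψ₁ ≫ A.hom = T.hom := by
    obtain ⟨L, _, τ, hinj, hτ⟩ := exists_injective_isUnit hu
    obtain ⟨t, ht, htG⟩ := hΨ₁ τ hτ
    refine Spec_hom_ext_of_injective hinj ?_
    rw [← reassoc_of% htG, Over.w G, ← ht]
    change t ≫ h ≫ W₀.ι ≫ T.hom = _
    rw [reassoc_of% hh, Category.assoc]
  refine ⟨Over.homMk Ψ₁ hΨk, u, hu, fun L _ _ τ hτ a₁ a₂ ha₁ ha₂ ↦ ?_⟩
  obtain ⟨t, ht, htG⟩ := hΨ₁ τ.toRingHom hτ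
  let c : specOver k L ⟶ overOpens T W₀ := Over.homMk (t ≫ h) (by
    change (t ≫ h) ≫ W₀.ι ≫ T.hom = _
    rw [Category.assoc, reassoc_of% hh, reassoc_of% ht]
    exact Over.w (specOverMap τ))
  have hc : c ≫ overOpensι T W₀ = specOverMap τ := by
    ext1
    change (t ≫ h) ≫ W₀.ι = _
    rw [Category.assoc, hh, ht]
    rfl
  have h₁ : c ≫ b₁ = a₁ := by
    rw [← cancel_mono (overOpensι Y U), Category.assoc, hb₁, reassoc_of% hc, ha₁, specOverMap_comp]
  have h₂ : c ≫ b₂ = a₂ := by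
    rw [← cancel_mono (overOpensι Y U), Category.assoc, hb₂, reassoc_of% hc, ha₂, specOverMap_comp]
  rw [← h₁, ← h₂, Category.assoc, Category.assoc, ← GrpObj.comp_div]
  ext1
  exact htG.symm.trans (Category.assoc _ _ _).symm

end

end

/-! ### Recovering the map on a local ring of the variety. -/

section

open IsLocalRing
open scoped TensorProduct MonObj
open MonoidalCategory CartesianMonoidalCategory

theorem RingHom.Flat.map_mem_nonZeroDivisors {R S : Type*} [CommRing R] [CommRing S] {f : R →+* S}
    (hf : f.Flat) {u : R} (hu : ∀ z, u * z = 0 → z = 0) : f u ∈ nonZeroDivisors S := by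
  algebraize [f]
  have : IsSMulRegular R u := by
    rw [isSMulRegular_iff_right_eq_zero_of_smul]
    exact fun z hz ↦ hu z hz
  have := this.of_flat (S := S)
  rw [isSMulRegular_iff_right_eq_zero_of_smul] at this
  rw [mem_nonZeroDivisors_iff]
  exact ⟨fun z hz ↦ this z hz, fun z hz ↦ this z (by rwa [smul_eq_mul, mul_comm])⟩

theorem exists_localization_algHom_flat {C : Type*} [CommRing C] {s m : Ideal C} [s.IsPrime]
    [m.IsPrime] (h : s ≤ m) :
    ∃ χ : Localization.AtPrime m →ₐ[C] Localization.AtPrime s, χ.toRingHom.Flat := by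
  have hle : m.primeCompl ≤ s.primeCompl := fun x hx hxs ↦ hx (h hxs)
  let χ : Localization.AtPrime m →ₐ[C] Localization.AtPrime s :=
    IsLocalization.liftAlgHom (M := m.primeCompl) (f := Algebra.ofId C _)
      fun y ↦ IsLocalization.map_units (M := s.primeCompl) _ ⟨y, hle y.2⟩
  refine ⟨χ, ?_⟩
  let := χ.toRingHom.toAlgebra
  have : IsScalarTower C (Localization.AtPrime m) (Localization.AtPrime s) :=
    .of_algebraMap_eq fun x ↦ (χ.commutes x).symm
  have := IsLocalization.isLocalization_of_submonoid_le (Localization.AtPrime m)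
    (Localization.AtPrime s) m.primeCompl s.primeCompl hle
  exact IsLocalization.flat (Localization.AtPrime s)
    (s.primeCompl.map (algebraMap C (Localization.AtPrime m)))

/-- A morphism from the spectrum of a local ring factors through any open subscheme containing the
image of the closed point. -/
theorem exists_lift_of_closedPoint_mem {S : Type u} [CommRing S] [IsLocalRing S] {X : Scheme.{u}}
    (f : Spec (.of S) ⟶ X) (V : X.Opens) (h : f (closedPoint S) ∈ V) :
    ∃ g : Spec (.of S) ⟶ V, g ≫ V.ι = f := by
  refine ⟨IsOpenImmersion.lift V.ι f ?_, IsOpenImmersion.lift_fac _ _ _⟩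
  rw [Scheme.Opens.range_ι]
  rintro _ ⟨x, rfl⟩
  exact ((specializes_closedPoint (R := S) x).map f.continuous).mem_open V.isOpen h

/-- A morphism from the spectrum of the fraction field of a local domain `O`
extends to `Spec O` if it does so over a faithfully flat local extension of `O`. -/
theorem exists_extend_of_faithfullyFlat {O S K L : Type u} [CommRing O] [IsDomain O] [Field K]
    [Algebra O K] [IsFractionRing O K] [CommRing S] [IsLocalRing S] [Algebra O S]
    [Module.FaithfullyFlat O S] [CommRing L] [Nontrivial L] {i : S →+* L}
    (hi : Function.Injective i) {j : K →+* L}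
    (hij : j.comp (algebraMap O K) = i.comp (algebraMap O S)) {A : Scheme.{u}}
    (θ : Spec (.of S) ⟶ A) (φ : Spec (.of K) ⟶ A)
    (h : Spec.map (CommRingCat.ofHom i) ≫ θ = Spec.map (CommRingCat.ofHom j) ≫ φ) :
    ∃ g : Spec (.of O) ⟶ A, Spec.map (CommRingCat.ofHom (algebraMap O K)) ≫ g = φ := by
  obtain ⟨V, hV, hθV, -⟩ :=
    exists_isAffineOpen_mem_and_subset (U := ⊤) (x := θ (closedPoint S)) trivial
  obtain ⟨θ', hθ'⟩ := exists_lift_of_closedPoint_mem θ V hθV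
  -- `Spec K` is one point, the image of any point of `Spec L`, and by `h` that point maps into `V`
  -- through `θ`.
  have hφV : φ (closedPoint K) ∈ V := by
    obtain ⟨y⟩ : Nonempty (Spec (.of L)) := inferInstanceAs (Nonempty (PrimeSpectrum L))
    have h1 : closedPoint K = Spec.map (CommRingCat.ofHom j) y :=
      Subsingleton.elim (α := PrimeSpectrum K) _ _
    have h2 : (Spec.map (CommRingCat.ofHom j) ≫ φ) y ∈ V := by
      rw [← h, ← hθ']
      exact (θ' (Spec.map (CommRingCat.ofHom i) y)).2
    rw [h1]
    exact h2
  obtain ⟨φ', hφ'⟩ := exists_lift_of_closedPoint_mem φ V hφV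
  obtain ⟨α, hα⟩ : ∃ α : Γ(A, V) ⟶ .of S, Spec.map α = θ' ≫ hV.isoSpec.hom :=
    Spec.map_surjective _
  obtain ⟨β, hβ⟩ : ∃ β : Γ(A, V) ⟶ .of K, Spec.map β = φ' ≫ hV.isoSpec.hom :=
    Spec.map_surjective _
  have hαβ : i.comp α.hom = j.comp β.hom := by
    have : Spec.map (α ≫ CommRingCat.ofHom i) = Spec.map (β ≫ CommRingCat.ofHom j) := by
      rw [Spec.map_comp, Spec.map_comp, hα, hβ, ← Category.assoc, ← Category.assoc]
      congr 1
      rw [← cancel_mono V.ι, Category.assoc, Category.assoc, hθ', hφ', h]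
    exact congr_arg CommRingCat.Hom.hom (Spec.map_injective this)
  obtain ⟨g₀, hg₀⟩ := exists_comp_eq_of_faithfullyFlat hi hij hαβ
  refine ⟨Spec.map (CommRingCat.ofHom g₀) ≫ hV.isoSpec.inv ≫ V.ι, ?_⟩
  rw [← Spec.map_comp_assoc, ← CommRingCat.ofHom_comp, hg₀, CommRingCat.ofHom_hom, hβ,
    Category.assoc, Iso.hom_inv_id_assoc, hφ']

/-- A map to a group scheme defined at all points of a smooth affine variety whose local ring is a
valuation ring extends to all local rings. -/
theorem exists_extend_localRing {k B : Type u} [Field k] [CommRing B] [IsDomain B] [Algebra k B]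
    (n : ℕ) [Algebra (MvPolynomial (Fin n) k) B]
    [IsScalarTower k (MvPolynomial (Fin n) k) B] [Algebra.Etale (MvPolynomial (Fin n) k) B]
    (A : Over (Spec (.of k))) [GrpObj A] (U : (specOver k B).left.Opens)
    (F : overOpens (specOver k B) U ⟶ A)
    (hU : ∀ (p : Ideal B) [hp : p.IsPrime], ValuationRing (Localization.AtPrime p) →
      (⟨p, hp⟩ : PrimeSpectrum B) ∈ U)
    (a : specOver k (FractionRing B) ⟶ overOpens (specOver k B) U)
    (ha : a ≫ overOpensι _ U = specOverMap (IsScalarTower.toAlgHom k B (FractionRing B)))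
    (q : Ideal B) [q.IsPrime] (σ : Localization.AtPrime q →ₐ[B] FractionRing B) :
    ∃ g : specOver k (Localization.AtPrime q) ⟶ A,
      specOverMap (σ.restrictScalars k) ≫ g = a ≫ F := by
  let O := Localization.AtPrime q
  let K := FractionRing B
  obtain ⟨Ψ, u, hu, hΨ⟩ := exists_extend_div q n A U F hU
  obtain ⟨s, _, hsm, hs₁, hs₂⟩ := exists_prime_le_diagPrime k q
  let S := Localization.AtPrime s
  let L := FractionRing S
  obtain ⟨χ, hχ⟩ := exists_localization_algHom_flat hsm
  let toL : S →ₐ[k] L := IsScalarTower.toAlgHom k S L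
  have hi : Function.Injective toL := IsFractionRing.injective S L
  have hunit {x : S} (hx : x ∈ nonZeroDivisors S) : IsUnit (toL x) :=
    IsLocalization.map_units (M := nonZeroDivisors S) L ⟨x, hx⟩
  let l : B →ₐ[k] S := (IsScalarTower.toAlgHom k (B ⊗[k] B) S).comp
    Algebra.TensorProduct.includeLeft
  let r : B →ₐ[k] S := (IsScalarTower.toAlgHom k (B ⊗[k] B) S).comp
    Algebra.TensorProduct.includeRight
  have hlflat : (Algebra.TensorProduct.includeLeftRingHom : B →+* B ⊗[k] B).Flat :=
    RingHom.flat_algebraMap_iff.mpr (Module.Flat.baseChange k B B)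
  have hl : (l : B →+* S).Flat := RingHom.Flat.comp hlflat
    (RingHom.flat_algebraMap_iff.mpr (IsLocalization.flat S s.primeCompl))
  -- The right coordinate is generic at `s`, so `f(y)` is defined over all of `S`; the left one
  -- extends to `K` only after passing to `L`.
  let κr : K →ₐ[k] S := IsLocalization.liftAlgHom (M := nonZeroDivisors B) (f := r) fun y ↦
    IsLocalization.map_units (M := s.primeCompl) S ⟨1 ⊗ₜ y,
      fun h ↦ nonZeroDivisors.coe_ne_zero y ((hs₂ y).mp h)⟩
  let κl : K →ₐ[k] L := IsLocalization.liftAlgHom (M := nonZeroDivisors B) (f := toL.comp l)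
    fun y ↦ hunit (hl.map_mem_nonZeroDivisors fun z hz ↦
      (mul_eq_zero.mp hz).resolve_left (nonZeroDivisors.coe_ne_zero y))
  have hκr (b : B) : κr (algebraMap B K b) = r b := IsLocalization.lift_eq _ b
  have hκl (b : B) : κl (algebraMap B K b) = toL (l b) := IsLocalization.lift_eq _ b
  let χ' : Localization.AtPrime (diagPrime k q) →ₐ[k] S := χ.restrictScalars k
  -- This is `(f(x) f(y)⁻¹) f(y)`, which agrees with `f(x)` over `L`.
  let θ : specOver k S ⟶ A := (specOverMap χ' ≫ Ψ) * (specOverMap κr ≫ a ≫ F)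
  have hθ : specOverMap toL ≫ θ = specOverMap κl ≫ a ≫ F := by
    have h1 := hΨ L (toL.comp χ') (hunit (hχ.map_mem_nonZeroDivisors hu))
      (specOverMap κl ≫ a) (specOverMap (toL.comp κr) ≫ a) (by
        rw [Category.assoc, ha, specOverMap_comp]
        congr 1
        ext b
        exact (hκl b).trans (congr_arg toL (χ.commutes (b ⊗ₜ 1))).symm) (by
        rw [Category.assoc, ha, specOverMap_comp]
        congr 1
        ext b
        exact congr_arg toL ((hκr b).trans (χ.commutes (1 ⊗ₜ b)).symm))
    rw [MonObj.comp_mul, ← Category.assoc, specOverMap_comp, h1, ← Category.assoc (specOverMap toL),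
      specOverMap_comp, Category.assoc, Category.assoc, div_mul_cancel]
  -- Since `s` lies over `q` on the left, `O → S` is a flat local homomorphism, hence faithfully
  -- flat.
  have hcomap : q = s.comap (Algebra.TensorProduct.includeLeftRingHom : B →+* B ⊗[k] B) :=
    Ideal.ext fun b ↦ (hs₁ b).symm
  let oS : O →+* S := Localization.localRingHom q s _ hcomap
  have hoS : oS.Flat := hlflat.localRingHom s q hcomap
  have hoSl : IsLocalHom oS := Localization.isLocalHom_localRingHom _ _ _ hcomap
  algebraize [oS]
  let := σ.toRingHom.toAlgebra
  have : IsScalarTower B O K := .of_algebraMap_eq fun x ↦ (σ.commutes x).symm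
  have : IsFractionRing O K := IsFractionRing.isFractionRing_of_isDomain_of_isLocalization
    q.primeCompl O K
  have : IsLocalHom (algebraMap O S) := hoSl
  have : Module.FaithfullyFlat O S := .of_flat_of_isLocalHom
  obtain ⟨g, hg⟩ := exists_extend_of_faithfullyFlat (O := O) (K := K) (i := toL.toRingHom) hi
    (j := κl.toRingHom) (by
      apply IsLocalization.ringHom_ext q.primeCompl
      ext b
      refine (congr_arg κl (σ.commutes b)).trans ((hκl b).trans (congr_arg toL ?_))
      exact (Localization.localRingHom_to_map q s _ hcomap b).symm) θ.left (a ≫ F).left congr(Over.Hom.left $hθ)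
  have hg' : Spec.map (CommRingCat.ofHom (σ.restrictScalars k).toRingHom) ≫ g = (a ≫ F).left := hg
  refine ⟨Over.homMk g ?_, ?_⟩
  · refine Spec_hom_ext_of_injective (τ := (σ.restrictScalars k).toRingHom) ?_ ?_
    · exact IsFractionRing.injective O K
    · rw [reassoc_of% hg', Over.w (a ≫ F)]
      exact (Over.w (specOverMap (σ.restrictScalars k))).symm
  · ext1
    exact hg'

end

/-! ### From local rings to the domain of a rational map. -/

section

open IsLocalRing
open scoped TensorProduct MonObj
open MonoidalCategory CartesianMonoidalCategory

/-- If `Spec B` is open in `X`, a localization of `B` away from functions not vanishing at a point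
maps to the stalk of `X` there. -/
lemma exists_localization_to_stalk {X : Scheme.{u}} {B : Type u} [CommRing B]
    (j : Spec (.of B) ⟶ X) [IsOpenImmersion j] (p : Spec (.of B)) (M : Submonoid B)
    (hM : ∀ y ∈ M, y ∉ p.asIdeal) :
    ∃ ε : CommRingCat.of (Localization M) ⟶ X.presheaf.stalk (j p),
      Spec.map ε ≫
        Spec.map (CommRingCat.ofHom (algebraMap B (Localization M))) ≫ j =
      X.fromSpecStalk (j p) := by
  let s : X.presheaf.stalk (j p) ⟶ (Spec (.of B)).presheaf.stalk p := j.stalkMap p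
  have : IsIso s := inferInstanceAs (IsIso (j.stalkMap p))
  let t : CommRingCat.of B ⟶ (Spec (.of B)).presheaf.stalk p := StructureSheaf.toStalk B p
  let α : CommRingCat.of B ⟶ X.presheaf.stalk (j p) := t ≫ inv s
  have hα : Spec.map α ≫ j = X.fromSpecStalk (j p) := by
    have h1 : Spec.map s ≫ X.fromSpecStalk (j p) = Spec.map t ≫ j :=
      (Scheme.SpecMap_stalkMap_fromSpecStalk j (x := p)).trans
        (congrArg (· ≫ j) (Spec.fromSpecStalk_eq' (CommRingCat.of B) p))
    rw [Spec.map_comp, Category.assoc, ← h1, ← Spec.map_comp_assoc, IsIso.hom_inv_id, Spec.map_id,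
      Category.id_comp]
  have hu (y : M) : IsUnit (α.hom y) := by
    have h1 : IsUnit (t.hom y.1) :=
      let p' : PrimeSpectrum B := p
      IsLocalization.map_units (M := p'.asIdeal.primeCompl)
        ((Spec.structureSheaf B).presheaf.stalk p') ⟨y.1, hM y.1 y.2⟩
    exact h1.map (inv s).hom
  let ε : CommRingCat.of (Localization M) ⟶ X.presheaf.stalk (j p) :=
    CommRingCat.ofHom (IsLocalization.lift hu)
  have hε : CommRingCat.ofHom (algebraMap B (Localization M)) ≫ ε = α := by
    ext1
    exact IsLocalization.lift_comp hu
  exact ⟨ε, by rw [← Spec.map_comp_assoc, hε, hα]⟩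

/-- A point of an affine chart of `X` lies in the domain of a rational map `X ⤏ A` if the map
extends from the function field to the local ring of the point. -/
lemma mem_domain_of_extend {S X A : Scheme.{u}} [IsIntegral X] (sX : X ⟶ S) (sA : A ⟶ S)
    [LocallyOfFiniteType sA] (h : X.PartialMap A) {B : Type u} [CommRing B] [IsDomain B]
    (j : Spec (.of B) ⟶ X) [IsOpenImmersion j] (q : Ideal B) [q.IsPrime]
    (x : Spec (.of B)) (hx : x.asIdeal = q)
    (σ : Localization.AtPrime q →+* FractionRing B)
    (hσ : σ.comp (algebraMap B _) = algebraMap B _)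
    (g : Spec (.of (Localization.AtPrime q)) ⟶ A)
    (hg : g ≫ sA = Spec.map (CommRingCat.ofHom (algebraMap B _)) ≫ j ≫ sX)
    (a : Spec (.of (FractionRing B)) ⟶ h.domain)
    (ha : a ≫ h.domain.ι = Spec.map (CommRingCat.ofHom (algebraMap B _)) ≫ j)
    (hag : Spec.map (CommRingCat.ofHom σ) ≫ g = a ≫ h.hom) :
    j x ∈ h.toRationalMap.domain := by
  let b : Spec (.of B) := (⟨⊥, Ideal.isPrime_bot⟩ : PrimeSpectrum B)
  obtain ⟨ε, hε⟩ := exists_localization_to_stalk j x q.primeCompl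
    (fun y hy hyx => hy (hx ▸ hyx))
  obtain ⟨ζ, hζ⟩ := exists_localization_to_stalk j b (nonZeroDivisors B)
    (fun y hy hy0 => nonZeroDivisors.ne_zero hy hy0)
  have hbq : b ⤳ x := (PrimeSpectrum.le_iff_specializes _ _).1 bot_le
  have hs : j b ⤳ j x := hbq.map j.continuous
  have hfac : Spec.map (X.presheaf.stalkSpecializes hs) ≫ Spec.map ε =
      Spec.map ζ ≫ Spec.map (CommRingCat.ofHom σ) := by
    have h1 : Spec.map (X.presheaf.stalkSpecializes hs) ≫ Spec.map ε ≫
        Spec.map (CommRingCat.ofHom (algebraMap B (Localization.AtPrime q))) =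
        Spec.map ζ ≫ Spec.map (CommRingCat.ofHom (algebraMap B _)) := by
      rw [← cancel_mono j]
      simp only [Category.assoc]
      rw [hζ, hε]
      rw [Scheme.SpecMap_stalkSpecializes_fromSpecStalk]
    rw [← hσ, CommRingCat.ofHom_comp, ← Spec.map_comp, ← Spec.map_comp, ← Spec.map_comp] at h1
    have h2 := Spec.map_injective h1
    rw [← Spec.map_comp, ← Spec.map_comp]
    congr 1
    ext1
    refine IsLocalization.ringHom_ext q.primeCompl ?_
    exact congrArg CommRingCat.Hom.hom h2
  have hg' : (Spec.map ε ≫ g) ≫ sA = X.fromSpecStalk (j x) ≫ sX := by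
    rw [Category.assoc, hg, ← hε]
    simp only [Category.assoc]
  -- As `A` is locally of finite type, the map on the local ring spreads out to a neighbourhood;
  -- agreement with `h` at the generic point `j b` makes the two partial maps equivalent.
  let P := Scheme.PartialMap.ofFromSpecStalk sX sA _ hg'
  have hqP : j x ∈ P.domain := Scheme.PartialMap.mem_domain_ofFromSpecStalk sX sA _ hg'
  have hbP : j b ∈ P.domain := hs.mem_open P.domain.2 hqP
  have hζa : X.fromSpecStalk (j b) = Spec.map ζ ≫ a ≫ h.domain.ι := by
    rw [ha, ← hζ]
  have hbh : j b ∈ h.domain := by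
    rw [← Scheme.fromSpecStalk_closedPoint (x := j b), hζa]
    exact Subtype.property ((Spec.map ζ ≫ a) (closedPoint (X.presheaf.stalk (j b))))
  rw [Scheme.RationalMap.mem_domain]
  refine ⟨P, hqP, Scheme.PartialMap.toRationalMap_eq_iff.2 <|
    Scheme.PartialMap.equiv_of_fromSpecStalkOfMem_eq P h hbP hbh ?_⟩
  have hP : P.fromSpecStalkOfMem hbP =
      Spec.map (X.presheaf.stalkSpecializes hs) ≫ P.fromSpecStalkOfMem hqP := by
    simp only [Scheme.PartialMap.fromSpecStalkOfMem, ← Category.assoc]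
    congr 1
    rw [← cancel_mono P.domain.ι]
    simp
  have hh : h.fromSpecStalkOfMem hbh = Spec.map ζ ≫ a ≫ h.hom := by
    simp only [Scheme.PartialMap.fromSpecStalkOfMem, ← Category.assoc]
    congr 1
    rw [← cancel_mono h.domain.ι, Scheme.Opens.fromSpecStalkOfMem_ι, hζa, Category.assoc]
  rw [hP, hh, Scheme.PartialMap.fromSpecStalkOfMem_ofFromSpecStalk, ← hag, ← Category.assoc, hfac,
    Category.assoc]

end

/-! ### Étale charts, the valuative criterion and the conclusion. -/

section

open IsLocalRing
open scoped TensorProduct MonObj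
open MonoidalCategory CartesianMonoidalCategory

/-- Locally, a smooth scheme over a field is étale over affine space. -/
lemma exists_etale_chart {k : Type u} [Field k] {X : Scheme.{u}} (f : X ⟶ Spec (.of k)) [Smooth f]
    (x : X) :
    ∃ (B : Type u) (_ : CommRing B) (_ : Algebra k B) (n : ℕ)
      (_ : Algebra (MvPolynomial (Fin n) k) B) (_ : IsScalarTower k (MvPolynomial (Fin n) k) B)
      (_ : Algebra.Etale (MvPolynomial (Fin n) k) B) (j : Spec (.of B) ⟶ X)
      (_ : IsOpenImmersion j), x ∈ Set.range j ∧
        j ≫ f = Spec.map (CommRingCat.ofHom (algebraMap k B)) := by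
  obtain ⟨U, hU, V, hV, hxV, e, hs⟩ := Smooth.exists_isStandardSmooth f x
  have hUt : U = ⊤ := by
    refine TopologicalSpace.Opens.ext (Set.eq_univ_of_forall fun z => ?_)
    have : Subsingleton (Spec (.of k)) := inferInstanceAs (Subsingleton (PrimeSpectrum k))
    exact Subsingleton.elim (f x) z ▸ e hxV
  have hiso : IsIso hU.fromSpec := by
    apply isIso_of_isOpenImmersion_of_opensRange_eq_top
    rw [IsAffineOpen.opensRange_fromSpec, hUt]
  let ψ : CommRingCat.of k ⟶ Γ(Spec (.of k), U) := Spec.preimage hU.fromSpec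
  have hψ : IsIso ψ := by
    have : IsIso (Scheme.Spec.map ψ.op) := by
      change IsIso (Spec.map ψ)
      rwa [Spec.map_preimage]
    have : IsIso ψ.op := isIso_of_reflects_iso ψ.op Scheme.Spec
    exact isIso_of_op ψ
  let ϖ : CommRingCat.of k ⟶ Γ(X, V) := ψ ≫ f.appLE U V e
  have hϖ : Spec.map ϖ = hV.fromSpec ≫ f := by
    rw [Spec.map_comp, Spec.map_preimage, IsAffineOpen.SpecMap_appLE_fromSpec]
  have hϖs : ϖ.hom.IsStandardSmooth :=
    (RingHom.isStandardSmooth_respectsIso.cancel_left_isIso ψ (f.appLE U V e)).2 hs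
  obtain ⟨n, g, hg, hge⟩ := hϖs.exists_etale_mvPolynomial
  let algB := ϖ.hom.toAlgebra
  let algP := g.toAlgebra
  refine ⟨Γ(X, V), inferInstance, algB, n, algP,
    IsScalarTower.of_algebraMap_eq' hg.symm, hge, hV.fromSpec, inferInstance, ?_, hϖ.symm⟩
  have := hV.range_fromSpec
  rw [this]
  exact hxV

/-- A morphism to a proper scheme extends from the fraction field to a valuation ring. -/
lemma exists_extend_of_valuationRing {S A : Scheme.{u}} (sA : A ⟶ S) [IsProper sA]
    {R K : Type u} [CommRing R] [IsDomain R] [ValuationRing R] [Field K] [Algebra R K]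
    [IsFractionRing R K] (a : Spec (.of K) ⟶ A) (b : Spec (.of R) ⟶ S)
    (h : a ≫ sA = Spec.map (CommRingCat.ofHom (algebraMap R K)) ≫ b) :
    ∃ g : Spec (.of R) ⟶ A, Spec.map (CommRingCat.ofHom (algebraMap R K)) ≫ g = a ∧
      g ≫ sA = b := by
  have hv : ValuativeCriterion sA := by
    have : IsProper sA := inferInstance
    rw [IsProper.eq_valuativeCriterion] at this
    exact this.1.1.1
  obtain ⟨⟨l⟩⟩ := hv.existence ⟨R, K, a, b, ⟨h⟩⟩
  exact ⟨l.l, l.fac_left, l.fac_right⟩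

variable {k : Type u} [Field k]

/-- By `hd` the domain of `h` is already maximal, so extending to the local ring of a point puts
that point in it. This is used twice: with the valuative criterion at valuation rings, giving `hU`,
and then with `exists_extend_localRing` everywhere. -/
lemma domain_eq_top (X A : Over (Spec (.of k))) [AlgebraicGeometry.IsIntegral X.left]
    [Smooth X.hom] [GrpObj A] [IsProper A.hom] (h : X.left.PartialMap A.left)
    (hd : h.toRationalMap.domain = h.domain) (hh : h.hom ≫ A.hom = h.domain.ι ≫ X.hom) :
    h.domain = ⊤ := by
  refine TopologicalSpace.Opens.ext (Set.eq_univ_of_forall fun x => ?_)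
  obtain ⟨B, _, _, n, _, _, _, j, _, ⟨y, rfl⟩, hj⟩ := exists_etale_chart X.hom x
  have : Nonempty (Spec (.of B)) := ⟨y⟩
  have : AlgebraicGeometry.IsIntegral (Spec (.of B)) := isIntegral_of_isOpenImmersion j
  have : IsDomain B := (affine_isIntegral_iff (.of B)).1 inferInstance
  let U : (specOver k B).left.Opens := j ⁻¹ᵁ h.domain
  let F : overOpens (specOver k B) U ⟶ A := Over.homMk ((j ∣_ h.domain) ≫ h.hom) (by
    dsimp [overOpens, specOver]
    rw [Category.assoc, hh, morphismRestrict_ι_assoc, hj])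
  have haU (z : (specOver k (FractionRing B)).left) :
      (specOverMap (IsScalarTower.toAlgHom k B (FractionRing B))).left z ∈ U := by
    -- The dense domain meets the chart at some `w`, and the generic point specializes to `w`.
    obtain ⟨_, hw, w, rfl⟩ := h.dense_domain.inter_open_nonempty _
      j.isOpenEmbedding.isOpen_range ⟨j y, y, rfl⟩ |>.imp fun _ hv => And.intro hv.2 hv.1
    refine Specializes.mem_open (y := w) ?_ U.2 hw
    refine (PrimeSpectrum.le_iff_specializes (R := B) _ _).1 fun b hb => ?_
    have hb' : algebraMap B (FractionRing B) b ∈ PrimeSpectrum.asIdeal (R := FractionRing B) z := hb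
    have hb0 : b = 0 := by
      by_contra hb0
      refine (PrimeSpectrum.isPrime (R := FractionRing B) z).ne_top
        (Ideal.eq_top_of_isUnit_mem _ hb' (IsUnit.mk0 _ ?_))
      simpa using hb0
    exact hb0 ▸ zero_mem _
  obtain ⟨a, ha⟩ := exists_lift_overOpens U
    (specOverMap (IsScalarTower.toAlgHom k B (FractionRing B))) haU
  have ha' : (a.left ≫ (j ∣_ h.domain)) ≫ h.domain.ι =
      Spec.map (CommRingCat.ofHom (algebraMap B (FractionRing B))) ≫ j := by
    rw [Category.assoc, morphismRestrict_ι, ← Category.assoc]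
    exact congrArg (· ≫ j) (congrArg (fun t => t.left) ha)
  have key (q : Ideal B) [hq : q.IsPrime] (x : Spec (.of B)) (hx : x.asIdeal = q)
      (g : Spec (.of (Localization.AtPrime q)) ⟶ A.left)
      (hg : g ≫ A.hom = Spec.map (CommRingCat.ofHom (algebraMap B _)) ≫ j ≫ X.hom)
      (hag : Spec.map (CommRingCat.ofHom (algebraMap (Localization.AtPrime q) (FractionRing B))) ≫
        g = (a.left ≫ (j ∣_ h.domain)) ≫ h.hom) : j x ∈ h.domain :=
    hd ▸ mem_domain_of_extend X.hom A.hom h j q x hx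
      (algebraMap (Localization.AtPrime q) (FractionRing B))
      (IsScalarTower.algebraMap_eq B (Localization.AtPrime q) (FractionRing B)).symm g hg _ ha' hag
  have hU (p : Ideal B) [hp : p.IsPrime] (hv : ValuationRing (Localization.AtPrime p)) :
      (⟨p, hp⟩ : PrimeSpectrum B) ∈ U := by
    obtain ⟨g, hg, hgA⟩ := exists_extend_of_valuationRing A.hom
      (R := Localization.AtPrime p) ((a.left ≫ (j ∣_ h.domain)) ≫ h.hom)
      (Spec.map (CommRingCat.ofHom (algebraMap B _)) ≫ j ≫ X.hom) (by
        rw [Category.assoc, hh, ← Category.assoc, ha', ← Spec.map_comp_assoc,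
          ← CommRingCat.ofHom_comp, ← IsScalarTower.algebraMap_eq, Category.assoc])
    exact key p (⟨p, hp⟩ : PrimeSpectrum B) rfl g hgA hg
  have hy : (PrimeSpectrum.asIdeal (R := B) y).IsPrime := PrimeSpectrum.isPrime (R := B) y
  obtain ⟨g, hg⟩ := exists_extend_localRing n A U F hU a ha (PrimeSpectrum.asIdeal (R := B) y)
    (IsScalarTower.toAlgHom B (Localization.AtPrime _) (FractionRing B))
  refine key (PrimeSpectrum.asIdeal (R := B) y) y rfl g.left ?_ ?_
  · refine (Over.w g).trans ?_
    rw [hj, ← Spec.map_comp, ← CommRingCat.ofHom_comp, ← IsScalarTower.algebraMap_eq]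
    rfl
  · exact (congrArg (fun t => t.left) hg).trans (Category.assoc _ _ _).symm

theorem mainTheorem7 {k : Type u} [Field k] (X A : Over (Spec (.of k)))
    [IsVarietyOver k X] [Smooth X.hom] [GrpObj A] [IsProper A.hom]
    (φ : X.left ⤏ A.left) [φ.IsOver (Spec (.of k))] :
    ∃! f : X ⟶ A, f.left.toRationalMap = φ := by
  have := IsVarietyOver.irreducibleSpace (k := k) (X := X)
  have := IsVarietyOver.isReduced (k := k) (X := X)
  have : AlgebraicGeometry.IsIntegral X.left := isIntegral_of_irreducibleSpace_of_isReduced _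
  have : A.left.IsSeparated := by
    rw [Scheme.isSeparated_iff, ← Limits.terminal.comp_from A.hom]
    infer_instance
  have : IsSeparated (A.left ↘ Spec (.of k)) := inferInstanceAs (IsSeparated A.hom)
  -- Separatedness of `A` gives a representative on the whole domain of definition of `φ`.
  let h := φ.toPartialMap
  have hφ : h.toRationalMap = φ := φ.toRationalMap_toPartialMap
  have hover : h.IsOver (Spec (.of k)) := inferInstance
  have hh : h.hom ≫ A.hom = h.domain.ι ≫ X.hom := hover.comp_over
  have htop : h.domain = ⊤ := domain_eq_top X A h (by rw [hφ]; rfl) hh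
  have hiso : IsIso h.domain.ι := by
    apply isIso_of_isOpenImmersion_of_opensRange_eq_top
    rw [Scheme.Opens.opensRange_ι, htop]
  have hequiv (g : X ⟶ A) : g.left.toRationalMap = φ ↔ h.hom = h.domain.ι ≫ g.left := by
    rw [← hφ, eq_comm, Scheme.PartialMap.toRationalMap_eq_iff,
      Scheme.PartialMap.equiv_toPartialMap_iff_of_isSeparated (S := Spec (.of k))]
  refine ⟨Over.homMk (inv h.domain.ι ≫ h.hom) ?_, ?_, fun g hg => ?_⟩
  · rw [Category.assoc, hh, IsIso.inv_hom_id_assoc]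
  · exact (hequiv _).2 (IsIso.hom_inv_id_assoc _ _).symm
  · ext1
    exact (IsIso.inv_comp_eq _).2 ((hequiv g).1 hg) |>.symm

end
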